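/- Let $G$ be a finite group, let $\mathbb{Z}G$ be its integral group ring, let $\Delta(G)$ be the augmentation ideal of $\mathbb{Z}G$ (the kernel of the augmentation $\sum_g c_g g\mapsto\sum_g c_g$), and let $\mathcal V(\mathbb{Z}G)$ be the group of units of $\mathbb{Z}G$ of augmentation $1$. For $n\ge 1$ put $$\mathcal V_n(\mathbb{Z}G)=\mathcal V(\mathbb{Z}G)\cap\bigl(1+\Delta(G)^n\bigr),\qquad \mathcal V_\omega(\mathbb{Z}G)=\bigcap_{n=1}^{\infty}\mathcal V_n(\mathbb{Z}G).$$ Then $\mathcal V_\omega(\mathbb{Z}G)=\{1\}$ if and only if either (i) $G$ is an abelian group of exponent $6$, or (ii) $G$ is a $p$-group for some prime $p$ (the trivial group being counted as a $p$-group). -/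

import Mathlib

namespace IntegralGroupRing

/-- The augmentation map of the integral group ring, sending a finite sum of terms
`c • g` to the sum of the coefficients `c`. -/
noncomputable def augmentation (G : Type*) [Group G] : MonoidAlgebra ℤ G →+* ℤ :=
  (MonoidAlgebra.lift ℤ ℤ G (1 : G →* ℤ)).toRingHom

/-- The augmentation ideal `Δ(G)` of the integral group ring. It is two-sided, being the kernel
of a ring homomorphism. -/
noncomputable def augmentationIdeal (G : Type*) [Group G] : Ideal (MonoidAlgebra ℤ G) :=
  RingHom.ker (augmentation G)

instance augmentationIdeal_isTwoSided (G : Type*) [Group G] :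
    (augmentationIdeal G).IsTwoSided :=
  inferInstanceAs (RingHom.ker (augmentation G)).IsTwoSided

/-- The group `V(ℤG)` of normalized units, that is, of units of augmentation one. -/
noncomputable def normalizedUnits (G : Type*) [Group G] : Subgroup (MonoidAlgebra ℤ G)ˣ :=
  (Units.map (augmentation G : MonoidAlgebra ℤ G →* ℤ)).ker

/-- The subgroup of the units of a ring that lie in `1 + I`, for a two-sided ideal `I`. -/
def unitsCongruentOne {R : Type*} [Ring R] (I : Ideal R) [I.IsTwoSided] : Subgroup Rˣ where
  carrier := {u | (u : R) - 1 ∈ I}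
  one_mem' := by simp
  mul_mem' := by
    intro u v hu hv
    have h : ((u * v : Rˣ) : R) - 1 = ((u : R) - 1) * v + ((v : R) - 1) := by
      push_cast
      noncomm_ring
    rw [Set.mem_ofPred_eq, h]
    exact I.add_mem (I.mul_mem_right _ hu) hv
  inv_mem' := by
    intro u hu
    have h : ((u⁻¹ : Rˣ) : R) - 1 = -(((u⁻¹ : Rˣ) : R) * ((u : R) - 1)) := by
      simp [mul_sub]
    rw [Set.mem_ofPred_eq, h]
    exact I.neg_mem (I.mul_mem_left _ hu)

/-- `V_n(ℤG) = V(ℤG) ∩ (1 + Δ(G) ^ n)`. -/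
noncomputable def augmentationFiltration (G : Type*) [Group G] (n : ℕ) :
    Subgroup (MonoidAlgebra ℤ G)ˣ :=
  normalizedUnits G ⊓ unitsCongruentOne (augmentationIdeal G ^ n)

/-- The `Δ`-adic residue `V_ω(ℤG)`, the intersection of the `V_n(ℤG)` over `n ≥ 1`. -/
noncomputable def adicResidue (G : Type*) [Group G] : Subgroup (MonoidAlgebra ℤ G)ˣ :=
  ⨅ (n : ℕ) (_ : 1 ≤ n), augmentationFiltration G n

theorem mem_adicResidue_iff (G : Type*) [Group G] (u : (MonoidAlgebra ℤ G)ˣ) :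
    u ∈ adicResidue G ↔ augmentation G u = 1 ∧
      ∀ n : ℕ, 1 ≤ n → (u : MonoidAlgebra ℤ G) - 1 ∈ augmentationIdeal G ^ n := by
  have hV : u ∈ normalizedUnits G ↔ augmentation G u = 1 := by
    rw [normalizedUnits, MonoidHom.mem_ker, Units.ext_iff]
    rfl
  simp only [adicResidue, Subgroup.mem_iInf, augmentationFiltration, Subgroup.mem_inf, hV]
  exact ⟨fun h => ⟨(h 1 le_rfl).1, fun n hn => (h n hn).2⟩, fun h n hn => ⟨h.1, h.2 n hn⟩⟩

end IntegralGroupRing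

namespace IntegralGroupRing

/-! For a finite `p`-group, `Δ` becomes nilpotent modulo `p`, so high powers of `Δ` are divisible by
high powers of `p` and meet in `0`. If `G` is abelian of exponent dividing 6, every complex
character takes values in `ℤ[ζ₆]`, whose units have absolute value 1; this makes every normalized
unit a group element (Higman), and mapping to the 2-part and the 3-part kills a group element lying
in the residue.

Conversely, suppose the residue is trivial. If `a` and `b` have coprime orders, then `(a - 1)(b -
1)` lies in every power of `Δ`. Three kinds of units exploit this. Commutators: `a` and `b` must
commute. Bass units: a polynomial `f` with `f(1) = 1` whose values are units satisfies `f(ab) = f(a)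
f(b)`. Specialized at roots of unity, this is an identity between distances `|z - 1|` which fails
unless the coprime orders are 2 and 3. Bicyclic-type units `1 + (t - 1)(a - 1) b (1 + a + a²)`: if
`t` has order 2 and `a` order 3, every `b` normalizes `⟨a⟩`. By Cauchy, a group that is not a
`p`-group then contains elements of orders 2 and 3, has exponent 6, and its 2-elements and
3-elements all commute. -/

/-! ### Augmentation ideals and functoriality of the residue -/

theorem augmentation_single {G : Type*} [Group G] (g : G) (c : ℤ) :
    augmentation G (MonoidAlgebra.single g c) = c := by
  change MonoidAlgebra.lift ℤ ℤ G (1 : G →* ℤ) _ = _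
  simp

theorem augmentation_of {G : Type*} [Group G] (g : G) :
    augmentation G (MonoidAlgebra.of ℤ G g) = 1 :=
  augmentation_single g 1

theorem of_sub_one_mem_augmentationIdeal {G : Type*} [Group G] (g : G) :
    MonoidAlgebra.of ℤ G g - 1 ∈ augmentationIdeal G := by
  rw [augmentationIdeal, RingHom.mem_ker, map_sub, augmentation_of, map_one, sub_self]

/-- A ring homomorphism mapping a left ideal `I` into `J` maps `I ^ n` into `J ^ n`. -/
theorem map_mem_pow {R S : Type*} [Ring R] [Ring S] (f : R →+* S) {I : Ideal R} {J : Ideal S}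
    (h : ∀ x ∈ I, f x ∈ J) (n : ℕ) : ∀ x ∈ I ^ n, f x ∈ J ^ n := by
  induction n with
  | zero => intro x _; rw [Submodule.pow_zero, Ideal.one_eq_top]; trivial
  | succ n ih =>
    intro x hx
    rw [Submodule.pow_succ] at hx ⊢
    have : I ^ n * I ≤ Ideal.comap f (J ^ n * J) := by
      rw [Ideal.mul_le]
      intro a ha b hb
      rw [Ideal.mem_comap, map_mul]
      exact Ideal.mul_mem_mul (ih a ha) (h b hb)
    exact this hx

theorem mem_adicResidue_of_sub_one_mem {G : Type*} [Group G] (u : (MonoidAlgebra ℤ G)ˣ)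
    (h : ∀ n : ℕ, (u : MonoidAlgebra ℤ G) - 1 ∈ augmentationIdeal G ^ n) :
    u ∈ adicResidue G := by
  refine (mem_adicResidue_iff G u).2 ⟨?_, fun n _ => h n⟩
  have := h 1
  rw [Submodule.pow_one, augmentationIdeal, RingHom.mem_ker, map_sub, map_one, sub_eq_zero] at this
  exact this

theorem mapDomain_mem_augmentationIdeal {G H : Type*} [Group G] [Group H] (f : G →* H)
    (x : MonoidAlgebra ℤ G) (hx : x ∈ augmentationIdeal G) :
    MonoidAlgebra.mapDomainRingHom ℤ f x ∈ augmentationIdeal H := by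
  have h : (augmentation H).comp (MonoidAlgebra.mapDomainRingHom ℤ f) = augmentation G := by
    refine MonoidAlgebra.ringHom_ext (fun r => ?_) (fun g => ?_) <;>
      simp [augmentation_single]
  rw [augmentationIdeal, RingHom.mem_ker] at hx ⊢
  rw [← hx, ← h]
  rfl

/-- The residue is functorial. -/
theorem map_mem_adicResidue {G H : Type*} [Group G] [Group H] (f : G →* H)
    {u : (MonoidAlgebra ℤ G)ˣ} (hu : u ∈ adicResidue G) :
    Units.map (MonoidAlgebra.mapDomainRingHom ℤ f : MonoidAlgebra ℤ G →* MonoidAlgebra ℤ H) u ∈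
      adicResidue H := by
  rw [mem_adicResidue_iff] at hu
  refine mem_adicResidue_of_sub_one_mem _ fun n => ?_
  rcases Nat.eq_zero_or_pos n with rfl | hn
  · rw [Submodule.pow_zero, Ideal.one_eq_top]; trivial
  · have := map_mem_pow (MonoidAlgebra.mapDomainRingHom ℤ f)
      (mapDomain_mem_augmentationIdeal f) n _ (hu.2 n hn)
    rwa [map_sub, map_one] at this

theorem adicResidue_eq_bot_of_injective {G H : Type*} [Group G] [Group H] {f : H →* G}
    (hf : Function.Injective f) (h : adicResidue G = ⊥) : adicResidue H = ⊥ := by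
  rw [eq_bot_iff]
  intro u hu
  have h1 := map_mem_adicResidue f hu
  rw [h, Subgroup.mem_bot] at h1
  rw [Subgroup.mem_bot]
  refine Units.map_injective (f := (MonoidAlgebra.mapDomainRingHom ℤ f :
    MonoidAlgebra ℤ H →* MonoidAlgebra ℤ G)) (MonoidAlgebra.mapDomain_injective hf) ?_
  rw [h1, map_one]

/-! ### Finite `p`-groups -/

/-- The augmentation of the group ring over an arbitrary commutative ring of coefficients. -/
noncomputable def augmentationOver (k G : Type*) [CommRing k] [Group G] :
    MonoidAlgebra k G →+* k :=
  (MonoidAlgebra.lift k k G (1 : G →* k)).toRingHom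

theorem augmentationOver_single {k G : Type*} [CommRing k] [Group G] (g : G) (c : k) :
    augmentationOver k G (MonoidAlgebra.single g c) = c := by
  change MonoidAlgebra.lift k k G (1 : G →* k) _ = _
  simp

/-- If every `g - 1` maps `v` into the left ideal `I`, so does the augmentation ideal. -/
theorem mul_mem_of_forall_of_mul_sub_mem {k G : Type*} [CommRing k] [Group G]
    (I : Ideal (MonoidAlgebra k G)) (v : MonoidAlgebra k G)
    (hv : ∀ g : G, MonoidAlgebra.of k G g * v - v ∈ I) (y : MonoidAlgebra k G)
    (hy : y ∈ RingHom.ker (augmentationOver k G)) : y * v ∈ I := by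
  have key : y * v - MonoidAlgebra.single 1 (augmentationOver k G y) * v ∈ I := by
    clear hy
    induction y using MonoidAlgebra.induction_linear with
    | zero => simp
    | add x y hx hy =>
      have : (x + y) * v - MonoidAlgebra.single 1 (augmentationOver k G (x + y)) * v =
        (x * v - MonoidAlgebra.single 1 (augmentationOver k G x) * v) +
        (y * v - MonoidAlgebra.single 1 (augmentationOver k G y) * v) := by
        rw [map_add, MonoidAlgebra.single_add]
        noncomm_ring
      rw [this]
      exact I.add_mem hx hy
    | single g c =>
      have : MonoidAlgebra.single g c * v -
          MonoidAlgebra.single 1 (augmentationOver k G (MonoidAlgebra.single g c)) * v =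
          MonoidAlgebra.single 1 c * (MonoidAlgebra.of k G g * v - v) := by
        rw [augmentationOver_single, mul_sub, ← mul_assoc, MonoidAlgebra.of_apply,
          MonoidAlgebra.single_mul_single, one_mul, mul_one]
      rw [this]
      exact I.mul_mem_left _ (hv g)
  rw [RingHom.mem_ker] at hy
  simpa [hy] using key

/-- The quotient by `I` is a nonzero finite group killed by `p`, so `p` divides its order. A
`p`-group acting on it and fixing `0` fixes a second point. -/
theorem exists_fixed_modulo_of_isPGroup {p : ℕ} [Fact p.Prime] {G : Type*} [Group G] [Finite G]
    (hG : IsPGroup p G) (I : Ideal (MonoidAlgebra (ZMod p) G)) (hI : I ≠ ⊤) :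
    ∃ v ∉ I, ∀ g : G, MonoidAlgebra.of (ZMod p) G g * v - v ∈ I := by
  classical
  have : Finite (MonoidAlgebra (ZMod p) G) :=
    have : Fintype G := Fintype.ofFinite G
    Finite.of_injective (fun x => (x.coeff : G → ZMod p))
      (fun x y h => MonoidAlgebra.coeff_injective (DFunLike.coe_injective h))
  let Q := MonoidAlgebra (ZMod p) G ⧸ I
  let act : MulAction G Q := MulAction.compHom Q (MonoidAlgebra.of (ZMod p) G)
  have : Finite Q := Finite.of_surjective _ (Submodule.Quotient.mk_surjective I)
  have hQ : Nontrivial Q := Submodule.Quotient.nontrivial_iff.2 hI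
  have hp : p ∣ Nat.card Q := by
    obtain ⟨x, hx⟩ := exists_ne (0 : Q)
    have hpx : p • x = 0 := by
      have : (p : MonoidAlgebra (ZMod p) G) = 0 := by
        rw [MonoidAlgebra.natCast_def]; simp
      rw [← Nat.cast_smul_eq_nsmul (MonoidAlgebra (ZMod p) G), this, zero_smul]
    rw [← addOrderOf_eq_prime hpx hx]
    exact addOrderOf_dvd_natCard x
  have h0 : (0 : Q) ∈ MulAction.fixedPoints G Q := fun g =>
    smul_zero (M := MonoidAlgebra (ZMod p) G) (A := Q) (MonoidAlgebra.of (ZMod p) G g)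
  obtain ⟨b, hb, hb0⟩ := hG.exists_fixed_point_of_prime_dvd_card_of_fixed_point Q hp h0
  obtain ⟨v, rfl⟩ := Submodule.Quotient.mk_surjective I b
  refine ⟨v, fun h => hb0 ((Submodule.Quotient.mk_eq_zero I).2 h).symm, fun g => ?_⟩
  rw [← Submodule.Quotient.eq]
  exact hb g

/-- For a maximal left ideal `I`, a nonzero fixed vector `v` modulo `I` gives `1 = m + r v` with `m
∈ I`. Then `x = x m + (x r) v`, and `x r`, again of augmentation zero, sends `v` into `I`. -/
theorem ker_augmentationOver_le_jacobson {p : ℕ} [Fact p.Prime] {G : Type*} [Group G] [Finite G]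
    (hG : IsPGroup p G) : RingHom.ker (augmentationOver (ZMod p) G) ≤
      Ring.jacobson (MonoidAlgebra (ZMod p) G) := by
  refine le_sInf fun I hI x hx => ?_
  obtain ⟨v, hvI, hv⟩ := exists_fixed_modulo_of_isPGroup hG I hI.1
  have hsup : I ⊔ Ideal.span {v} = ⊤ := by
    refine hI.2 _ (lt_of_le_of_ne le_sup_left fun h => hvI ?_)
    rw [h]
    exact Ideal.mem_sup_right (Ideal.mem_span_singleton_self v)
  have h1 : (1 : MonoidAlgebra (ZMod p) G) ∈ I ⊔ Ideal.span {v} := hsup ▸ Submodule.mem_top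
  obtain ⟨m, hm, w, hw, hmw⟩ := Submodule.mem_sup.1 h1
  obtain ⟨r, rfl⟩ := Ideal.mem_span_singleton'.1 hw
  have : x = x * m + x * r * v := by rw [mul_assoc, ← mul_add, hmw, mul_one]
  rw [this]
  exact I.add_mem (I.mul_mem_left _ hm)
    (mul_mem_of_forall_of_mul_sub_mem I v hv _ (Ideal.mul_mem_right _ _ hx))

/-- Modulo `p`, `Δ` lands in the Jacobson radical of the finite ring `𝔽_p G`, which is nilpotent. -/
theorem exists_pow_augmentationIdeal_dvd_coeff {p : ℕ} [Fact p.Prime] {G : Type*} [Group G]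
    [Finite G] (hG : IsPGroup p G) :
    ∃ m : ℕ, ∀ x ∈ augmentationIdeal G ^ m, ∃ y : MonoidAlgebra ℤ G, x = (p : ℤ) • y := by
  have : Finite (MonoidAlgebra (ZMod p) G) :=
    have : Fintype G := Fintype.ofFinite G
    Finite.of_injective (fun x => (x.coeff : G → ZMod p))
      (fun x y h => MonoidAlgebra.coeff_injective (DFunLike.coe_injective h))
  obtain ⟨m, hm⟩ := IsSemiprimaryRing.isNilpotent (R := MonoidAlgebra (ZMod p) G)
  refine ⟨m, fun x hx => ?_⟩
  let φ := MonoidAlgebra.mapRingHom G (Int.castRingHom (ZMod p))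
  have hφ : ∀ x ∈ augmentationIdeal G, φ x ∈ Ring.jacobson (MonoidAlgebra (ZMod p) G) := by
    intro x hx
    refine ker_augmentationOver_le_jacobson hG ?_
    have h : (augmentationOver (ZMod p) G).comp φ =
        (Int.castRingHom (ZMod p)).comp (augmentation G) := by
      refine MonoidAlgebra.ringHom_ext (fun r => ?_) (fun g => ?_) <;>
        simp [φ, augmentation_single, augmentationOver_single]
    rw [augmentationIdeal, RingHom.mem_ker] at hx
    rw [RingHom.mem_ker, ← RingHom.comp_apply, h, RingHom.comp_apply, hx, map_zero]
  have h0 : φ x = 0 := by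
    have := map_mem_pow φ hφ m x hx
    rw [hm] at this
    simpa using this
  have hd : ∀ g, (p : ℤ) ∣ x.coeff g := by
    intro g
    have : (φ x).coeff g = 0 := by rw [h0]; simp
    rw [MonoidAlgebra.coeff_mapRingHom] at this
    exact (ZMod.intCast_zmod_eq_zero_iff_dvd _ _).1 this
  refine ⟨.ofCoeff (x.coeff.mapRange (· / (p : ℤ)) (by simp)), ?_⟩
  ext g
  rw [MonoidAlgebra.coeff_smul_apply, MonoidAlgebra.coeff_ofCoeff, Finsupp.mapRange_apply,
    smul_eq_mul, Int.mul_ediv_cancel' (hd g)]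

/-- The augmentation ideal of a finite `p`-group is residually nilpotent. -/
theorem eq_zero_of_mem_pow_augmentationIdeal {p : ℕ} [Fact p.Prime] {G : Type*} [Group G]
    [Finite G] (hG : IsPGroup p G) (x : MonoidAlgebra ℤ G)
    (hx : ∀ n : ℕ, x ∈ augmentationIdeal G ^ n) : x = 0 := by
  obtain ⟨m, hm⟩ := exists_pow_augmentationIdeal_dvd_coeff hG
  have key : ∀ k : ℕ, ∀ x ∈ augmentationIdeal G ^ (m * k),
      ∃ y : MonoidAlgebra ℤ G, x = ((p : ℤ) ^ k) • y := by
    intro k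
    induction k with
    | zero => intro x _; exact ⟨x, by simp⟩
    | succ k ih =>
      intro x hx
      rw [mul_add, mul_one, Ideal.IsTwoSided.pow_add] at hx
      induction hx using Submodule.mul_induction_on' with
      | mem_mul_mem a ha b hb =>
        obtain ⟨y, rfl⟩ := ih a ha
        obtain ⟨z, rfl⟩ := hm b hb
        exact ⟨y * z, by rw [smul_mul_smul_comm, pow_succ]⟩
      | add a _ b _ ha hb =>
        obtain ⟨y, rfl⟩ := ha
        obtain ⟨z, rfl⟩ := hb
        exact ⟨y + z, by rw [smul_add]⟩
  ext g
  -- The exponent `|x_g|` suffices because `p ^ |x_g| > |x_g|`.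
  refine Int.eq_zero_of_abs_lt_dvd (m := (p : ℤ) ^ (x.coeff g).natAbs) ?_ ?_
  · obtain ⟨y, hy⟩ := key (x.coeff g).natAbs x (hx _)
    have h2 : x.coeff g = (p : ℤ) ^ (x.coeff g).natAbs * y.coeff g := by
      conv_lhs => rw [hy]
      rw [MonoidAlgebra.coeff_smul_apply, smul_eq_mul]
    exact ⟨_, h2⟩
  · rw [Int.abs_eq_natAbs]
    exact_mod_cast Nat.lt_pow_self (Fact.out : p.Prime).one_lt

theorem adicResidue_eq_bot_of_isPGroup {p : ℕ} (hp : p.Prime) {G : Type*} [Group G]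
    [Finite G] (hG : IsPGroup p G) : adicResidue G = ⊥ := by
  have : Fact p.Prime := ⟨hp⟩
  rw [eq_bot_iff]
  intro u hu
  rw [mem_adicResidue_iff] at hu
  rw [Subgroup.mem_bot, Units.ext_iff, Units.val_one, ← sub_eq_zero]
  refine eq_zero_of_mem_pow_augmentationIdeal hG _ fun n => ?_
  rcases Nat.eq_zero_or_pos n with rfl | hn
  · rw [Submodule.pow_zero, Ideal.one_eq_top]; trivial
  · exact hu.2 n hn

/-! ### Units for abelian groups of exponent dividing 6 -/

open ComplexConjugate

theorem exists_eq_int_add_int_mul_of_pow_six_eq_one {ζ : ℂ} (hζ : IsPrimitiveRoot ζ 6) {z : ℂ}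
    (hz : z ^ 6 = 1) : ∃ m k : ℤ, z = m + k * ζ := by
  have h2 : ζ ^ 2 = ζ - 1 := by
    have := hζ.isRoot_cyclotomic (by norm_num)
    rw [Polynomial.cyclotomic_six] at this
    simp at this
    linear_combination this
  obtain ⟨i, -, rfl⟩ := hζ.eq_pow_of_pow_eq_one hz
  clear hz
  induction i with
  | zero => exact ⟨1, 0, by simp⟩
  | succ i ih =>
    obtain ⟨m, k, h⟩ := ih
    refine ⟨-k, m + k, ?_⟩
    rw [pow_succ, h]
    push_cast
    linear_combination (k : ℂ) * h2

theorem normSq_int_add_int_mul {ζ : ℂ} (hζ : IsPrimitiveRoot ζ 6) (m k : ℤ) :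
    Complex.normSq (m + k * ζ) = ((m ^ 2 + m * k + k ^ 2 : ℤ) : ℝ) := by
  have h2 : ζ ^ 2 = ζ - 1 := by
    have := hζ.isRoot_cyclotomic (by norm_num)
    rw [Polynomial.cyclotomic_six] at this
    simp at this
    linear_combination this
  have h1 : ζ * conj ζ = 1 := by
    rw [Complex.mul_conj, Complex.normSq_eq_norm_sq, hζ.norm'_eq_one (by norm_num)]
    simp
  have h3 : conj ζ = 1 - ζ := by
    have h0 : ζ ≠ 0 := hζ.ne_zero (by norm_num)
    apply mul_left_cancel₀ h0
    rw [h1]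
    linear_combination h2
  apply Complex.ofReal_injective
  rw [← Complex.mul_conj, map_add, map_mul, map_intCast, map_intCast, h3]
  push_cast
  linear_combination -(k : ℂ) ^ 2 * h2

/-- The ring homomorphism from the integral group ring induced by a complex character. -/
noncomputable def characterRingHom {G : Type*} [CommGroup G] (ψ : AddChar (Additive G) ℂ) :
    MonoidAlgebra ℤ G →+* ℂ :=
  (MonoidAlgebra.lift ℤ ℂ G
    { toFun := fun g => ψ (Additive.ofMul g)
      map_one' := by simp
      map_mul' := fun a b => by rw [ofMul_mul, AddChar.map_add_eq_mul] }).toRingHom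

theorem characterRingHom_single {G : Type*} [CommGroup G] (ψ : AddChar (Additive G) ℂ) (g : G)
    (c : ℤ) : characterRingHom ψ (MonoidAlgebra.single g c) = c * ψ (Additive.ofMul g) := by
  change MonoidAlgebra.lift ℤ ℂ G _ _ = _
  simp

/-- Character values lie in `ℤ[ζ₆]`, where the squared absolute value is an integer. For a unit it
is a nonnegative integer with an integer inverse. -/
theorem normSq_characterRingHom_unit {G : Type*} [CommGroup G] (hG : ∀ g : G, g ^ 6 = 1)
    (ψ : AddChar (Additive G) ℂ) (u : (MonoidAlgebra ℤ G)ˣ) :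
    Complex.normSq (characterRingHom ψ u) = 1 := by
  have hζ := Complex.isPrimitiveRoot_exp 6 (by norm_num)
  have key : ∀ x : MonoidAlgebra ℤ G, ∃ N : ℤ, Complex.normSq (characterRingHom ψ x) = N := by
    intro x
    obtain ⟨m, k, h⟩ : ∃ m k : ℤ,
        characterRingHom ψ x = m + k * Complex.exp (2 * Real.pi * Complex.I / (6 : ℕ)) := by
      induction x using MonoidAlgebra.induction_linear with
      | zero => exact ⟨0, 0, by simp⟩
      | add x y hx hy =>
        obtain ⟨m, k, h⟩ := hx
        obtain ⟨m', k', h'⟩ := hy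
        refine ⟨m + m', k + k', ?_⟩
        rw [map_add, h, h']
        push_cast
        ring
      | single g c =>
        obtain ⟨m, k, h⟩ := exists_eq_int_add_int_mul_of_pow_six_eq_one hζ
          (z := ψ (Additive.ofMul g)) (by
            rw [← AddChar.map_nsmul_eq_pow, ← ofMul_pow, hG]; simp)
        refine ⟨c * m, c * k, ?_⟩
        rw [characterRingHom_single, h]
        push_cast
        ring
    exact ⟨_, by rw [h, normSq_int_add_int_mul hζ]⟩
  obtain ⟨N, hN⟩ := key u
  obtain ⟨N', hN'⟩ := key ↑u⁻¹
  have h1 : Complex.normSq (characterRingHom ψ u) * Complex.normSq (characterRingHom ψ ↑u⁻¹) = 1 := by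
    rw [← map_mul, ← map_mul, Units.mul_inv, map_one, map_one]
  have h0 : 0 ≤ Complex.normSq (characterRingHom ψ u) := Complex.normSq_nonneg _
  rw [hN, hN'] at h1
  rw [hN] at h0 ⊢
  norm_cast at h0 h1 ⊢
  exact Int.eq_one_of_mul_eq_one_right h0 h1

theorem sum_characterRingHom {G : Type*} [CommGroup G] [Fintype G] (x : MonoidAlgebra ℤ G) :
    ∑ ψ : AddChar (Additive G) ℂ, characterRingHom ψ x = Fintype.card G * x.coeff 1 := by
  classical
  induction x using MonoidAlgebra.induction_linear with
  | zero => simp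
  | add x y hx hy =>
    simp_rw [map_add, Finset.sum_add_distrib, hx, hy]
    simp [mul_add]
  | single g c =>
    simp_rw [characterRingHom_single, ← Finset.mul_sum]
    rw [AddChar.sum_apply_eq_ite]
    by_cases hg : g = 1
    · subst hg
      simp [mul_comm]
    · simp [hg]

/-- With `v` the image of `u` under `g ↦ g⁻¹`, every character sends `u v` to `|ψ(u)|² = 1`. Fourier
inversion gives `u v` the coefficient 1 at the identity, and that coefficient is the sum of squares.
-/
theorem sum_sq_coeff_eq_one {G : Type*} [CommGroup G] [Fintype G] (hG : ∀ g : G, g ^ 6 = 1)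
    (u : (MonoidAlgebra ℤ G)ˣ) : ∑ g, (u : MonoidAlgebra ℤ G).coeff g ^ 2 = 1 := by
  classical
  let v : MonoidAlgebra ℤ G := MonoidAlgebra.mapDomainRingHom ℤ (invMonoidHom : G →* G) u
  have hv : ∀ ψ : AddChar (Additive G) ℂ, characterRingHom ψ (u * v) = 1 := by
    intro ψ
    have h : (characterRingHom ψ).comp
        (MonoidAlgebra.mapDomainRingHom ℤ (invMonoidHom : G →* G)) =
        (starRingEnd ℂ).comp (characterRingHom ψ) := by
      refine MonoidAlgebra.ringHom_ext (fun r => ?_) (fun g => ?_) <;>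
        simp [characterRingHom_single, AddChar.map_neg_eq_conj]
    have h' : characterRingHom ψ v = conj (characterRingHom ψ u) := RingHom.congr_fun h u
    rw [map_mul, h', Complex.mul_conj, normSq_characterRingHom_unit hG]
    simp
  have hsum := sum_characterRingHom ((u : MonoidAlgebra ℤ G) * v)
  simp_rw [hv] at hsum
  rw [Finset.sum_const, Finset.card_univ, AddChar.card_eq, Fintype.card_additive] at hsum
  have h1 : ((u : MonoidAlgebra ℤ G) * v).coeff 1 = 1 := by
    have h0 : (Fintype.card G : ℂ) ≠ 0 := by exact_mod_cast Fintype.card_ne_zero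
    have : (((u : MonoidAlgebra ℤ G) * v).coeff 1 : ℂ) = 1 := by
      apply mul_left_cancel₀ h0
      rw [← hsum]
      simp
    exact_mod_cast this
  rw [MonoidAlgebra.coeff_mul_apply_left, Finsupp.sum_fintype _ _ (by simp)] at h1
  rw [← h1]
  refine Finset.sum_congr rfl fun g _ => ?_
  have : v.coeff (g⁻¹ * 1) = (u : MonoidAlgebra ℤ G).coeff g := by
    rw [mul_one]
    exact Finsupp.mapDomain_apply (f := fun g : G => g⁻¹) inv_injective _ g
  rw [this, sq]

/-- Higman: the normalized units of a finite abelian group of exponent dividing `6` are trivial. -/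
theorem exists_eq_of_of_pow_six {G : Type*} [CommGroup G] [Finite G] (hG : ∀ g : G, g ^ 6 = 1)
    (u : (MonoidAlgebra ℤ G)ˣ) (hu : augmentation G u = 1) :
    ∃ g : G, (u : MonoidAlgebra ℤ G) = MonoidAlgebra.of ℤ G g := by
  classical
  have : Fintype G := Fintype.ofFinite G
  have hs := sum_sq_coeff_eq_one hG u
  obtain ⟨g, hg⟩ : ∃ g, (u : MonoidAlgebra ℤ G).coeff g ≠ 0 := by
    by_contra! h
    simp [h] at hs
  have h0 : ∀ h, h ≠ g → (u : MonoidAlgebra ℤ G).coeff h = 0 := by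
    intro h hne
    have hle : ∑ x ∈ {g, h}, (u : MonoidAlgebra ℤ G).coeff x ^ 2 ≤ 1 := by
      rw [← hs]
      exact Finset.sum_le_sum_of_subset_of_nonneg (Finset.subset_univ _)
        fun _ _ _ => sq_nonneg _
    rw [Finset.sum_pair hne.symm] at hle
    have h1 : 0 < (u : MonoidAlgebra ℤ G).coeff g ^ 2 := by positivity
    have h2 : (u : MonoidAlgebra ℤ G).coeff h ^ 2 = 0 :=
      le_antisymm (by omega) (sq_nonneg _)
    exact pow_eq_zero_iff (two_ne_zero) |>.1 h2
  have hu' : (u : MonoidAlgebra ℤ G) =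
      MonoidAlgebra.single g ((u : MonoidAlgebra ℤ G).coeff g) := by
    ext h
    by_cases hh : h = g
    · subst hh; simp
    · rw [h0 h hh, MonoidAlgebra.coeff_single, Finsupp.single_eq_of_ne hh]
  rw [hu', augmentation_single] at hu
  refine ⟨g, ?_⟩
  rw [hu', hu, MonoidAlgebra.of_apply]

theorem eq_one_of_mem_adicResidue_of_hom {G H : Type*} [Group G] [Group H] (f : G →* H)
    (hH : adicResidue H = ⊥) {u : (MonoidAlgebra ℤ G)ˣ} (hu : u ∈ adicResidue G) {g : G}
    (hg : (u : MonoidAlgebra ℤ G) = MonoidAlgebra.of ℤ G g) : f g = 1 := by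
  have h := map_mem_adicResidue f hu
  rw [hH, Subgroup.mem_bot, Units.ext_iff] at h
  have h' : MonoidAlgebra.of ℤ H (f g) = MonoidAlgebra.of ℤ H 1 := by
    rw [map_one, ← Units.val_one, ← h]
    simp [hg]
  exact MonoidAlgebra.of_injective h'

/-- A unit in the residue is a group element `g`. Cubing maps onto a 2-group and squaring onto a
3-group, whose residues are trivial, so `g³ = g² = 1`. -/
theorem adicResidue_eq_bot_of_pow_six {G : Type*} [CommGroup G] [Finite G]
    (hG : ∀ g : G, g ^ 6 = 1) : adicResidue G = ⊥ := by
  rw [eq_bot_iff]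
  intro u hu
  obtain ⟨g, hg⟩ := exists_eq_of_of_pow_six hG u ((mem_adicResidue_iff G u).1 hu).1
  have h3 : g ^ 3 = 1 := by
    have hp : IsPGroup 2 (powMonoidHom 3 : G →* G).range := by
      rintro ⟨_, x, rfl⟩
      refine ⟨1, Subtype.ext ?_⟩
      simp [← pow_mul, hG]
    have := eq_one_of_mem_adicResidue_of_hom (powMonoidHom 3 : G →* G).rangeRestrict
      (adicResidue_eq_bot_of_isPGroup Nat.prime_two hp) hu hg
    simpa [Subtype.ext_iff] using this
  have h2 : g ^ 2 = 1 := by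
    have hp : IsPGroup 3 (powMonoidHom 2 : G →* G).range := by
      rintro ⟨_, x, rfl⟩
      refine ⟨1, Subtype.ext ?_⟩
      simp [← pow_mul, hG]
    have := eq_one_of_mem_adicResidue_of_hom (powMonoidHom 2 : G →* G).rangeRestrict
      (adicResidue_eq_bot_of_isPGroup Nat.prime_three hp) hu hg
    simpa [Subtype.ext_iff] using this
  have h1 : g = 1 := by
    rw [pow_succ, h2, one_mul] at h3
    exact h3
  rw [Subgroup.mem_bot, Units.ext_iff, hg, h1, map_one, Units.val_one]

/-! ### Elements of coprime orders -/

theorem exists_pow_sub_one_eq_left {R : Type*} [Ring R] (a : R) (r : ℕ) :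
    ∃ t : R, a ^ r - 1 = r * (a - 1) + t * (a - 1) * (a - 1) := by
  induction r with
  | zero => exact ⟨0, by simp⟩
  | succ r ih =>
    obtain ⟨t, ht⟩ := ih
    refine ⟨r + a * t, ?_⟩
    have h : a ^ (r + 1) - 1 = a * (a ^ r - 1) + (a - 1) := by
      rw [pow_succ']; noncomm_ring
    have hr : a * (r : R) = r * a := (Nat.cast_commute r a).eq.symm
    rw [h, ht, mul_add, ← mul_assoc a, hr]
    push_cast
    noncomm_ring

theorem exists_pow_sub_one_eq_right {R : Type*} [Ring R] (a : R) (r : ℕ) :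
    ∃ t : R, a ^ r - 1 = (a - 1) * r + (a - 1) * ((a - 1) * t) := by
  induction r with
  | zero => exact ⟨0, by simp⟩
  | succ r ih =>
    obtain ⟨t, ht⟩ := ih
    refine ⟨r + t * a, ?_⟩
    have h : a ^ (r + 1) - 1 = (a ^ r - 1) * a + (a - 1) := by
      rw [pow_succ]; noncomm_ring
    have hr : (r : R) * a = a * r := (Nat.cast_commute r a).eq
    rw [h, ht, add_mul, mul_assoc _ _ a, hr]
    push_cast
    noncomm_ring

/-- Put `x = (a - 1)(b - 1)`. Expanding `a ^ r = 1` and `b ^ s = 1` shows that `r (a - 1)` and `(b -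
1) s` are quadratic in `a - 1` and `b - 1`. Bézout for `r`, `s` then puts `x` in `I x + x I`, so
membership climbs one power at a time. -/
theorem sub_one_mul_sub_one_mem_pow {R : Type*} [Ring R] (I : Ideal R) [I.IsTwoSided] {a b : R}
    {r s : ℕ} (hrs : r.Coprime s) (ha : a ^ r = 1) (hb : b ^ s = 1) (haI : a - 1 ∈ I)
    (hbI : b - 1 ∈ I) (n : ℕ) : (a - 1) * (b - 1) ∈ I ^ n := by
  obtain ⟨t, ht⟩ := exists_pow_sub_one_eq_left a r
  obtain ⟨t', ht'⟩ := exists_pow_sub_one_eq_right b s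
  rw [ha, sub_self] at ht
  rw [hb, sub_self] at ht'
  have hr : (r : R) * (a - 1) = -(t * (a - 1) * (a - 1)) := eq_neg_of_add_eq_zero_left ht.symm
  have hs : (b - 1) * (s : R) = -((b - 1) * ((b - 1) * t')) := eq_neg_of_add_eq_zero_left ht'.symm
  obtain ⟨u, v, huv⟩ := Nat.isCoprime_iff_coprime.2 hrs
  have key : (a - 1) * (b - 1) = -(u : R) * (t * (a - 1) * ((a - 1) * (b - 1))) -
      ((a - 1) * (b - 1)) * (b - 1) * (t' * v) := by
    have huv' : (u : R) * r + s * v = 1 := by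
      have : ((u * r + s * v : ℤ) : R) = 1 := by rw [mul_comm (s : ℤ), huv, Int.cast_one]
      simpa using this
    have hc : (s : R) * v * ((a - 1) * (b - 1)) = (a - 1) * ((b - 1) * s) * v := by
      have h1 : ((s * v : ℤ) : R) * ((a - 1) * (b - 1)) = ((a - 1) * (b - 1)) * ((s * v : ℤ) : R) :=
        (Int.cast_commute _ _).eq
      push_cast at h1
      rw [h1]
      simp only [mul_assoc]
    calc (a - 1) * (b - 1) = ((u : R) * r + s * v) * ((a - 1) * (b - 1)) := by rw [huv', one_mul]
      _ = (u : R) * (r * (a - 1)) * (b - 1) + s * v * ((a - 1) * (b - 1)) := by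
        rw [add_mul]; simp only [mul_assoc]
      _ = _ := by rw [hc, hr, hs]; noncomm_ring
  induction n with
  | zero => rw [Submodule.pow_zero, Ideal.one_eq_top]; trivial
  | succ n ih =>
    rw [key]
    refine Ideal.sub_mem _ (Ideal.mul_mem_left _ _ ?_) (Ideal.mul_mem_right _ _ ?_)
    · rw [Ideal.IsTwoSided.pow_succ]
      exact Ideal.mul_mem_mul (I.mul_mem_left _ haI) ih
    · rw [Submodule.pow_succ]
      exact Ideal.mul_mem_mul ih hbI

theorem of_sub_one_mul_of_sub_one_mem {G : Type*} [Group G] {a b : G}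
    (h : (orderOf a).Coprime (orderOf b)) (n : ℕ) :
    (MonoidAlgebra.of ℤ G a - 1) * (MonoidAlgebra.of ℤ G b - 1) ∈ augmentationIdeal G ^ n :=
  sub_one_mul_sub_one_mem_pow _ h (by rw [← map_pow, pow_orderOf_eq_one, map_one])
    (by rw [← map_pow, pow_orderOf_eq_one, map_one]) (of_sub_one_mem_augmentationIdeal a)
    (of_sub_one_mem_augmentationIdeal b) n

/-- `a⁻¹b⁻¹ab - 1 = a⁻¹b⁻¹((a - 1)(b - 1) - (b - 1)(a - 1))` lies in every power of `Δ`. -/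
theorem commute_of_coprime_orderOf {G : Type*} [Group G] (hG : adicResidue G = ⊥) {a b : G}
    (h : (orderOf a).Coprime (orderOf b)) : Commute a b := by
  let u : (MonoidAlgebra ℤ G)ˣ := Units.map (MonoidAlgebra.of ℤ G) (toUnits (a⁻¹ * b⁻¹ * (a * b)))
  have hu : u ∈ adicResidue G := by
    refine mem_adicResidue_of_sub_one_mem u fun n => ?_
    have : (u : MonoidAlgebra ℤ G) - 1 = MonoidAlgebra.of ℤ G (a⁻¹ * b⁻¹) *
        ((MonoidAlgebra.of ℤ G a - 1) * (MonoidAlgebra.of ℤ G b - 1) -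
          (MonoidAlgebra.of ℤ G b - 1) * (MonoidAlgebra.of ℤ G a - 1)) := by
      have h1 : (u : MonoidAlgebra ℤ G) = MonoidAlgebra.of ℤ G (a⁻¹ * b⁻¹) *
          (MonoidAlgebra.of ℤ G a * MonoidAlgebra.of ℤ G b) := by
        rw [← map_mul, ← map_mul]; rfl
      have h2 : (1 : MonoidAlgebra ℤ G) = MonoidAlgebra.of ℤ G (a⁻¹ * b⁻¹) *
          (MonoidAlgebra.of ℤ G b * MonoidAlgebra.of ℤ G a) := by
        rw [← map_mul, ← map_mul, ← map_one (MonoidAlgebra.of ℤ G)]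
        congr 1
        group
      rw [h1]
      nth_rewrite 1 [h2]
      noncomm_ring
    rw [this]
    exact Ideal.mul_mem_left _ _ (Ideal.sub_mem _ (of_sub_one_mul_of_sub_one_mem h n)
      (of_sub_one_mul_of_sub_one_mem h.symm n))
  rw [hG, Subgroup.mem_bot, Units.ext_iff] at hu
  have h1 : a⁻¹ * b⁻¹ * (a * b) = 1 :=
    MonoidAlgebra.of_injective (R := ℤ) (by rw [map_one]; exact hu)
  have h2 : a * b = b * a := by
    have := congrArg (fun x => b * a * x) h1
    simpa [mul_assoc] using this
  exact h2

/-! ### Bass units -/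

open Polynomial in
/-- The polynomial whose value at a group element `g` with `g ^ n = 1` is a Bass unit. -/
noncomputable def bassPolynomial (n k m : ℕ) (c : ℤ) : ℤ[X] :=
  (∑ i ∈ Finset.range k, X ^ i) ^ m - C c * ∑ i ∈ Finset.range n, X ^ i

theorem aeval_bassPolynomial {R : Type*} [CommRing R] (x : R) (n k m : ℕ) (c : ℤ) :
    Polynomial.aeval x (bassPolynomial n k m c) =
      (∑ i ∈ Finset.range k, x ^ i) ^ m - c * ∑ i ∈ Finset.range n, x ^ i := by
  simp [bassPolynomial]

theorem exists_one_add_mul_pow_eq {R : Type*} [CommRing R] {N : R} {n : ℤ} (hN : N * N = n * N)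
    (d : ℤ) (m : ℕ) :
    ∃ e : ℤ, (1 + d * N) ^ m = 1 + e * N ∧ (1 + d * n) ^ m = 1 + e * n := by
  induction m with
  | zero => exact ⟨0, by simp, by simp⟩
  | succ m ih =>
    obtain ⟨e, h1, h2⟩ := ih
    refine ⟨d + e + d * e * n, ?_, ?_⟩
    · rw [pow_succ, h1]
      push_cast
      linear_combination (d * e : R) * hN
    · rw [pow_succ, h2]
      ring

/-- `N` spans a part on which `S` and `T` act as the scalars `k` and `l`; the corrections `c N` and
`c' N` make both factors act there as 1. -/
theorem bass_mul_eq_one {R : Type*} [CommRing R] {S T N : R} {n k l c c' d : ℤ} {m : ℕ}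
    (hn : n ≠ 0) (hST : S * T = 1 + d * N) (hS : S * N = k * N) (hT : T * N = l * N)
    (hN : N * N = n * N) (hkl : k * l = 1 + d * n) (hk : k ^ m = 1 + c * n)
    (hl : l ^ m = 1 + c' * n) : (S ^ m - c * N) * (T ^ m - c' * N) = 1 := by
  have hpow : ∀ {S : R} {k : ℤ}, S * N = k * N → ∀ m : ℕ, S ^ m * N = (k : R) ^ m * N := by
    intro S k h m
    induction m with
    | zero => simp
    | succ m ih => rw [pow_succ, mul_assoc, h, mul_left_comm, ih, pow_succ]; ring
  obtain ⟨e, h1, h2⟩ := exists_one_add_mul_pow_eq hN d m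
  -- Computing `(k l) ^ m` in two ways gives this relation times `n`.
  have hz : e - c * l ^ m - c' * k ^ m + c * c' * n = 0 := by
    apply mul_right_cancel₀ hn
    have h3 : k ^ m * l ^ m = 1 + e * n := by rw [← mul_pow, hkl, h2]
    linear_combination -h3 + (l ^ m - c' * n) * hk + hl
  have hz' : (e : R) - c * (l : R) ^ m - c' * (k : R) ^ m + c * c' * n = 0 := by
    exact_mod_cast congrArg (Int.cast : ℤ → R) hz
  have h3 : S ^ m * T ^ m = 1 + e * N := by rw [← mul_pow, hST, h1]
  linear_combination h3 - (c : R) * hpow hT m - (c' : R) * hpow hS m + (c * c' : R) * hN + N * hz'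

theorem geom_sum_mul_geom_sum_pow {R : Type*} [CommRing R] (x : R) (k l : ℕ) :
    (∑ i ∈ Finset.range k, x ^ i) * ∑ j ∈ Finset.range l, (x ^ k) ^ j =
      ∑ i ∈ Finset.range (k * l), x ^ i := by
  induction l with
  | zero => simp
  | succ l ih =>
    rw [Finset.sum_range_succ, mul_add, ih, mul_add, mul_one, Finset.sum_range_add, mul_comm _ ((x ^ k) ^ l),
      Finset.mul_sum]
    simp_rw [pow_add, pow_mul]

theorem isUnit_aeval_bassPolynomial {R : Type*} [CommRing R] {x : R} {n k m c : ℕ} (hn : 0 < n)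
    (hm : 0 < m) (hx : x ^ n = 1) (hk : k ^ m = 1 + c * n) :
    IsUnit (Polynomial.aeval x (bassPolynomial n k m c)) := by
  rw [aeval_bassPolynomial]
  set N := ∑ i ∈ Finset.range n, x ^ i with hNdef
  have hxN : x * N = N := by
    have := mul_geom_sum x n
    rw [hx, sub_self, sub_mul, one_mul] at this
    exact sub_eq_zero.1 this
  have hxiN : ∀ i : ℕ, x ^ i * N = N := by
    intro i
    induction i with
    | zero => simp
    | succ i ih => rw [pow_succ, mul_assoc, hxN, ih]
  have hS : ∀ l : ℕ, (∑ i ∈ Finset.range l, x ^ i) * N = ((l : ℤ) : R) * N := by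
    intro l
    simp [Finset.sum_mul, hxiN]
  have hT : ∀ l : ℕ, (∑ i ∈ Finset.range l, (x ^ k) ^ i) * N = ((l : ℤ) : R) * N := by
    intro l
    simp [Finset.sum_mul, ← pow_mul, hxiN]
  have hkl : k * k ^ (m - 1) = 1 + c * n := by rw [← hk, mul_pow_sub_one hm.ne']
  obtain ⟨e, he, -⟩ := exists_one_add_mul_pow_eq (R := ℤ) (N := n) (n := n) rfl c (m - 1)
  -- The choice `l = k ^ (m - 1)` makes `k l = 1 + c n`, so the geometric sum of length `k l` wraps
  -- around to `1 + c N`.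
  refine IsUnit.of_mul_eq_one _ (bass_mul_eq_one (T := ∑ j ∈ Finset.range (k ^ (m - 1)), (x ^ k) ^ j)
    (k := k) (l := (k ^ (m - 1) : ℕ)) (d := c) (c' := e) (n := n) (by exact_mod_cast hn.ne')
    ?_ (hS k) (hT _) (hS n) (by exact_mod_cast hkl) (by exact_mod_cast hk) ?_)
  · rw [geom_sum_mul_geom_sum_pow, hkl, add_comm 1, Finset.sum_range_succ, mul_comm c, pow_mul, hx,
      one_pow, ← geom_sum_mul_geom_sum_pow, hx, ← hNdef]
    simp
    ring
  · simp only [Int.cast_id] at he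
    rw [← he]
    push_cast
    rw [← pow_mul, mul_comm, pow_mul]
    congr 1
    exact_mod_cast hk

theorem bassPolynomial_eval_one {n k m c : ℕ} (hk : k ^ m = 1 + c * n) :
    (bassPolynomial n k m c).eval 1 = 1 := by
  have := congrArg (Nat.cast : ℕ → ℤ) hk
  push_cast at this
  simp [bassPolynomial, Polynomial.eval_finsetSum, this]

theorem sub_one_pow_mul_aeval_bassPolynomial {z : ℂ} {n k m c : ℕ} (hz : z ^ n = 1) (hz1 : z ≠ 1) :
    (z - 1) ^ m * Polynomial.aeval z (bassPolynomial n k m c) = (z ^ k - 1) ^ m := by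
  have h0 : ∑ i ∈ Finset.range n, z ^ i = 0 := by
    have := mul_geom_sum z n
    rw [hz, sub_self] at this
    exact (mul_eq_zero.1 this).resolve_left (sub_ne_zero.2 hz1)
  rw [aeval_bassPolynomial, h0, mul_zero, sub_zero, ← mul_pow, mul_geom_sum]

open Polynomial in
/-- Modulo `(a - 1) * (b - 1)`, a polynomial of value one at one is multiplicative. -/
theorem aeval_mul_sub_mem {R : Type*} [CommRing R] (J : Ideal R) {a b : R}
    (hab : (a - 1) * (b - 1) ∈ J) (f : ℤ[X]) (hf : f.eval 1 = 1) :
    aeval (a * b) f - aeval a f * aeval b f ∈ J := by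
  have hdvd : ∀ (x : R) (g : ℤ[X]), x - 1 ∣ aeval x g - ((g.eval 1 : ℤ) : R) := by
    intro x g
    have h := sub_dvd_eval_sub x 1 (g.map (Int.castRingHom R))
    rw [eval_map, eval_one_map] at h
    exact h
  -- Unlike multiplicativity, this congruence is linear in `g`, so monomials suffice: `(a ^ i - 1)(b
  -- ^ i - 1)` is a multiple of `(a - 1)(b - 1)`.
  have h1 : ∀ g : ℤ[X], aeval (a * b) g - aeval a g - aeval b g + ((g.eval 1 : ℤ) : R) ∈ J := by
    intro g
    induction g using Polynomial.induction_on' with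
    | add p q hp hq =>
      have : aeval (a * b) (p + q) - aeval a (p + q) - aeval b (p + q) +
          (((p + q).eval 1 : ℤ) : R) =
          (aeval (a * b) p - aeval a p - aeval b p + ((p.eval 1 : ℤ) : R)) +
          (aeval (a * b) q - aeval a q - aeval b q + ((q.eval 1 : ℤ) : R)) := by
        simp only [map_add, eval_add]
        push_cast
        ring
      rw [this]
      exact J.add_mem hp hq
    | monomial i c =>
      obtain ⟨y, hy⟩ := sub_one_dvd_pow_sub_one a i
      obtain ⟨z, hz⟩ := sub_one_dvd_pow_sub_one b i
      have : aeval (a * b) (monomial i c) - aeval a (monomial i c) - aeval b (monomial i c) +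
          (((monomial i c).eval 1 : ℤ) : R) = (c * y * z) * ((a - 1) * (b - 1)) := by
        simp only [aeval_monomial, eval_monomial, mul_pow, one_pow, mul_one]
        simp only [algebraMap_int_eq, eq_intCast]
        linear_combination (c : R) * (b ^ i - 1) * hy + (c : R) * (a - 1) * y * hz
      rw [this]
      exact J.mul_mem_left _ hab
  have h2 : (aeval a f - 1) * (aeval b f - 1) ∈ J := by
    obtain ⟨y, hy⟩ := hdvd a f
    obtain ⟨z, hz⟩ := hdvd b f
    rw [hf, Int.cast_one] at hy hz
    rw [hy, hz, mul_mul_mul_comm]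
    exact J.mul_mem_right _ hab
  have h3 := J.sub_mem (h1 f) h2
  rw [hf, Int.cast_one] at h3
  convert h3 using 1
  ring

theorem aeval_of_mul_eq {H : Type*} [CommGroup H] (hH : adicResidue H = ⊥) {a b : H}
    (h : (orderOf a).Coprime (orderOf b)) (f : Polynomial ℤ) (hf : f.eval 1 = 1)
    (ha : IsUnit (Polynomial.aeval (MonoidAlgebra.of ℤ H a) f))
    (hb : IsUnit (Polynomial.aeval (MonoidAlgebra.of ℤ H b) f))
    (hab : IsUnit (Polynomial.aeval (MonoidAlgebra.of ℤ H (a * b)) f)) :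
    Polynomial.aeval (MonoidAlgebra.of ℤ H (a * b)) f =
      Polynomial.aeval (MonoidAlgebra.of ℤ H a) f * Polynomial.aeval (MonoidAlgebra.of ℤ H b) f := by
  obtain ⟨u, hu⟩ := ha
  obtain ⟨v, hv⟩ := hb
  obtain ⟨w, hw⟩ := hab
  have hmem : w * (u * v)⁻¹ ∈ adicResidue H := by
    refine mem_adicResidue_of_sub_one_mem _ fun n => ?_
    have h1 : ((w * (u * v)⁻¹ : (MonoidAlgebra ℤ H)ˣ) : MonoidAlgebra ℤ H) - 1 =
        (w - u * v) * ((u * v)⁻¹ : (MonoidAlgebra ℤ H)ˣ) := by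
      rw [sub_mul, ← Units.val_mul, ← Units.val_mul, ← Units.val_mul, mul_inv_cancel, Units.val_one]
    rw [h1, hu, hv, hw, map_mul]
    exact Ideal.mul_mem_right _ _ (aeval_mul_sub_mem _ (of_sub_one_mul_of_sub_one_mem h n) f hf)
  rw [hH, Subgroup.mem_bot, mul_inv_eq_one] at hmem
  rw [← hu, ← hv, ← hw, hmem, Units.val_mul]

/-- The group of `rs`-th roots of unity is isomorphic to `⟨g⟩`, so it inherits a trivial residue;
its inclusion in `ℂ` evaluates the group ring identity at `α` and `β`. -/
theorem aeval_bassPolynomial_mul_eq {G : Type*} [Group G] (hG : adicResidue G = ⊥) {g : G}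
    {r s k m c : ℕ} (hg : orderOf g = r * s) (hrs : r.Coprime s) (hr : 0 < r) (hs : 0 < s)
    (hm : 0 < m) (hk : k ^ m = 1 + c * (r * s)) {α β : ℂ} (hα : IsPrimitiveRoot α r)
    (hβ : IsPrimitiveRoot β s) :
    Polynomial.aeval (α * β) (bassPolynomial (r * s) k m c) =
      Polynomial.aeval α (bassPolynomial (r * s) k m c) *
        Polynomial.aeval β (bassPolynomial (r * s) k m c) := by
  have hn : 0 < r * s := Nat.mul_pos hr hs
  have : NeZero (r * s) := ⟨hn.ne'⟩
  let H := rootsOfUnity (r * s) ℂ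
  have hcard : Nat.card H = Nat.card (Subgroup.zpowers g) := by
    rw [Nat.card_zpowers, hg]
    exact Complex.card_rootsOfUnity (r * s)
  have e : H ≃* Subgroup.zpowers g := mulEquivOfCyclicCardEq hcard
  have hH : adicResidue H = ⊥ := adicResidue_eq_bot_of_injective
    (f := (Subgroup.zpowers g).subtype.comp e.toMonoidHom)
    (Subtype.val_injective.comp e.injective) hG
  let χ : H →* ℂ := (Units.coeHom ℂ).comp H.subtype
  have hχ : Function.Injective χ := Units.val_injective.comp Subtype.val_injective
  have hαn : α ^ (r * s) = 1 := by rw [pow_mul, hα.pow_eq_one, one_pow]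
  have hβn : β ^ (r * s) = 1 := by rw [mul_comm, pow_mul, hβ.pow_eq_one, one_pow]
  let a : H := rootsOfUnity.mkOfPowEq α hαn
  let b : H := rootsOfUnity.mkOfPowEq β hβn
  have ha : χ a = α := rfl
  have hb : χ b = β := rfl
  have hab : (orderOf a).Coprime (orderOf b) := by
    rw [← orderOf_injective χ hχ, ← orderOf_injective χ hχ, ha, hb, ← hα.eq_orderOf,
      ← hβ.eq_orderOf]
    exact hrs
  have hpow : ∀ x : H, MonoidAlgebra.of ℤ H x ^ (r * s) = 1 := by
    intro x
    rw [← map_pow]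
    have : x ^ (r * s) = 1 := Subtype.ext x.2
    rw [this, map_one]
  have hunit : ∀ x : H, IsUnit (Polynomial.aeval (MonoidAlgebra.of ℤ H x)
      (bassPolynomial (r * s) k m c)) := fun x => isUnit_aeval_bassPolynomial hn hm (hpow x) hk
  have key := congrArg (MonoidAlgebra.lift ℤ ℂ H χ) (aeval_of_mul_eq hH hab
    (bassPolynomial (r * s) k m c) (bassPolynomial_eval_one hk) (hunit a) (hunit b) (hunit (a * b)))
  rw [map_mul (MonoidAlgebra.lift ℤ ℂ H χ), ← Polynomial.aeval_algHom_apply,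
    ← Polynomial.aeval_algHom_apply, ← Polynomial.aeval_algHom_apply, MonoidAlgebra.lift_of, MonoidAlgebra.lift_of,
    MonoidAlgebra.lift_of, map_mul χ, ha, hb] at key
  exact key

/-- Euler's theorem supplies `m`. Off 1, the Bass value at `z` is `((z ^ k - 1) / (z - 1)) ^ m`;
absolute values remove the `m`-th power. -/
theorem norm_pow_sub_one_mul_eq {G : Type*} [Group G] (hG : adicResidue G = ⊥) {g : G}
    {r s k : ℕ} (hg : orderOf g = r * s) (hrs : r.Coprime s) (hr : 1 < r) (hs : 1 < s)
    (hk : k.Coprime (r * s)) {α β : ℂ} (hα : IsPrimitiveRoot α r)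
    (hβ : IsPrimitiveRoot β s) :
    ‖(α * β) ^ k - 1‖ * ‖α - 1‖ * ‖β - 1‖ = ‖α ^ k - 1‖ * ‖β ^ k - 1‖ * ‖α * β - 1‖ := by
  have hn : 0 < r * s := by positivity
  obtain ⟨m, hm, c, hc⟩ : ∃ m, 0 < m ∧ ∃ c, k ^ m = 1 + c * (r * s) := by
    refine ⟨(r * s).totient, Nat.totient_pos.2 hn, ?_⟩
    have h1 : 1 ≤ k ^ (r * s).totient := by
      refine Nat.one_le_pow _ _ (Nat.pos_of_ne_zero ?_)
      rintro rfl
      rw [Nat.coprime_zero_left] at hk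
      have := Nat.eq_one_of_mul_eq_one_right hk
      omega
    obtain ⟨c, hc⟩ := (Nat.modEq_iff_dvd' h1).1 (Nat.ModEq.pow_totient hk).symm
    exact ⟨c, by rw [mul_comm c, ← hc]; omega⟩
  have key := aeval_bassPolynomial_mul_eq hG hg hrs (by omega) (by omega) hm hc hα hβ
  have hαn : α ^ (r * s) = 1 := by rw [pow_mul, hα.pow_eq_one, one_pow]
  have hβn : β ^ (r * s) = 1 := by rw [mul_comm, pow_mul, hβ.pow_eq_one, one_pow]
  have h1 := sub_one_pow_mul_aeval_bassPolynomial (k := k) (m := m) (c := c) hαn (hα.ne_one hr)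
  have h2 := sub_one_pow_mul_aeval_bassPolynomial (k := k) (m := m) (c := c) hβn (hβ.ne_one hs)
  have hαβ : α * β ≠ 1 := by
    intro h
    have h' : α ^ s = 1 := by
      have := congrArg (· ^ s) h
      simpa [mul_pow, hβ.pow_eq_one] using this
    have := Nat.Coprime.eq_one_of_dvd hrs (hα.dvd_of_pow_eq_one _ h')
    omega
  have h3 := sub_one_pow_mul_aeval_bassPolynomial (z := α * β) (k := k) (m := m) (c := c)
    (by rw [mul_pow, hαn, hβn, mul_one]) hαβ
  have h4 : (((α * β) ^ k - 1) * (α - 1) * (β - 1)) ^ m =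
      ((α ^ k - 1) * (β ^ k - 1) * (α * β - 1)) ^ m := by
    rw [mul_pow _ _ m, mul_pow _ _ m, mul_pow _ _ m, mul_pow _ _ m, ← h1, ← h2, ← h3, key]
    ring
  have h5 := congrArg norm h4
  rw [norm_pow, norm_pow] at h5
  have h6 := (pow_left_inj₀ (norm_nonneg _) (norm_nonneg _) hm.ne').1 h5
  simpa only [norm_mul] using h6

/-! ### Distances between roots of unity: only coprime orders 2 and 3 survive -/

theorem sq_norm_sub_one_of_norm_eq_one {z : ℂ} (hz : ‖z‖ = 1) :
    ‖z - 1‖ ^ 2 = 2 - 2 * z.re := by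
  have h : z.re ^ 2 + z.im ^ 2 = 1 := by
    have := Complex.sq_norm z
    rw [hz, Complex.normSq_apply] at this
    linarith
  rw [Complex.sq_norm, Complex.normSq_apply]
  simp only [Complex.sub_re, Complex.sub_im, Complex.one_re, Complex.one_im]
  linarith

theorem eq_or_mul_eq_one_of_re_eq {z w : ℂ} (hz : ‖z‖ = 1) (hw : ‖w‖ = 1) (h : z.re = w.re) :
    z = w ∨ z * w = 1 := by
  have hz' := Complex.sq_norm z
  have hw' := Complex.sq_norm w
  rw [hz, Complex.normSq_apply] at hz'
  rw [hw, Complex.normSq_apply] at hw'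
  have h2 : z.im ^ 2 = w.im ^ 2 := by
    rw [h] at hz'
    linarith
  rcases sq_eq_sq_iff_eq_or_eq_neg.1 h2 with h3 | h3
  · exact Or.inl (Complex.ext h h3)
  · right
    apply Complex.ext
    · rw [Complex.mul_re, h, h3, Complex.one_re]; linarith
    · rw [Complex.mul_im, h, h3, Complex.one_im]; ring

theorem eq_or_mul_eq_one_of_norm_sub_one_eq {z w : ℂ} (hz : ‖z‖ = 1) (hw : ‖w‖ = 1)
    (h : ‖z - 1‖ = ‖w - 1‖) : z = w ∨ z * w = 1 := by
  refine eq_or_mul_eq_one_of_re_eq hz hw ?_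
  have h1 := sq_norm_sub_one_of_norm_eq_one hz
  have h2 := sq_norm_sub_one_of_norm_eq_one hw
  rw [h] at h1
  linarith

/-- With `k ≡ 1` mod `r` and `k ≡ -1` mod `s`, the identity becomes `|αβ⁻¹ - 1| = |αβ - 1|`, which
forces `β² = 1` or `α² = 1`. -/
theorem not_two_lt_of_adicResidue_eq_bot {G : Type*} [Group G] (hG : adicResidue G = ⊥) {g : G}
    {r s : ℕ} (hg : orderOf g = r * s) (hrs : r.Coprime s) (hr : 2 < r) (hs : 2 < s) : False := by
  have hα := Complex.isPrimitiveRoot_exp r (by omega)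
  have hβ := Complex.isPrimitiveRoot_exp s (by omega)
  set α := Complex.exp (2 * Real.pi * Complex.I / r)
  set β := Complex.exp (2 * Real.pi * Complex.I / s)
  obtain ⟨k, hkr, hks⟩ := Nat.chineseRemainder hrs 1 (s - 1)
  have hk : k.Coprime (r * s) := by
    refine Nat.Coprime.mul_right ?_ ?_
    · rw [Nat.Coprime, hkr.gcd_eq, Nat.gcd_one_left]
    · rw [Nat.Coprime, hks.gcd_eq]
      exact (Nat.coprime_self_sub_left (by omega : 1 ≤ s)).2 (Nat.coprime_one_left s)
  have hkey := norm_pow_sub_one_mul_eq hG hg hrs (by omega) (by omega) hk hα hβ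
  have hαk : α ^ k = α := by
    rw [pow_eq_pow_of_modEq hkr hα.pow_eq_one, pow_one]
  have hβk : β ^ k = β ^ (s - 1) := pow_eq_pow_of_modEq hks hβ.pow_eq_one
  have hβs : β ^ (s - 1) * β = 1 := by rw [pow_sub_one_mul (by omega), hβ.pow_eq_one]
  have hα1 : ‖α‖ = 1 := hα.norm'_eq_one (by omega)
  have hβ1 : ‖β‖ = 1 := hβ.norm'_eq_one (by omega)
  have hnorm : ‖β ^ (s - 1) - 1‖ = ‖β - 1‖ := by
    rw [← mul_one ‖β ^ (s - 1) - 1‖, ← hβ1, ← norm_mul, sub_mul, hβs, one_mul, norm_sub_rev]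
  have hα0 : ‖α - 1‖ ≠ 0 := norm_ne_zero_iff.2 (sub_ne_zero.2 (hα.ne_one (by omega)))
  have hβ0 : ‖β - 1‖ ≠ 0 := norm_ne_zero_iff.2 (sub_ne_zero.2 (hβ.ne_one (by omega)))
  rw [mul_pow, hαk, hβk, hnorm] at hkey
  have heq : ‖α * β ^ (s - 1) - 1‖ = ‖α * β - 1‖ := by
    apply mul_right_cancel₀ (mul_ne_zero hα0 hβ0)
    linear_combination hkey
  rcases eq_or_mul_eq_one_of_norm_sub_one_eq (by simp [hα1, hβ1]) (by simp [hα1, hβ1]) heq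
    with h | h
  · have h' := mul_left_cancel₀ (hα.ne_zero (by omega)) h
    rw [h', ← sq] at hβs
    exact absurd (Nat.le_of_dvd two_pos (hβ.dvd_of_pow_eq_one _ hβs)) (by omega)
  · have h' : α ^ 2 = 1 := by linear_combination h - α ^ 2 * hβs
    exact absurd (Nat.le_of_dvd two_pos (hα.dvd_of_pow_eq_one _ h')) (by omega)

theorem not_three_lt_of_adicResidue_eq_bot {G : Type*} [Group G] (hG : adicResidue G = ⊥) {g : G}
    {s : ℕ} (hg : orderOf g = 2 * s) (hs2 : Nat.Coprime 2 s) (hs : 3 < s) : False := by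
  have hα : IsPrimitiveRoot (-1 : ℂ) 2 := IsPrimitiveRoot.neg_one 0 (by norm_num)
  have hβ := Complex.isPrimitiveRoot_exp s (by omega)
  set β := Complex.exp (2 * Real.pi * Complex.I / s)
  -- The exponent used is `k + 1 = s - 2`: it is prime to `2 s` because `s` is odd, and `β ^ (s - 2)
  -- = β⁻²`.
  obtain ⟨k, rfl⟩ := Nat.exists_eq_add_of_lt (show 2 < s by omega)
  have hodd : Odd (2 + k + 1) := Nat.coprime_two_left.1 hs2
  have hkodd : Odd (k + 1) := by
    rw [Nat.odd_iff] at hodd ⊢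
    omega
  have hk : (k + 1).Coprime (2 * (2 + k + 1)) := by
    refine Nat.Coprime.mul_right (Nat.coprime_two_right.2 hkodd) ?_
    rw [add_assoc, Nat.coprime_add_self_right]
    exact Nat.coprime_two_right.2 hkodd
  have hkey := norm_pow_sub_one_mul_eq hG hg hs2 (by omega) (by omega) hk hα hβ
  have hβ1 : ‖β‖ = 1 := hβ.norm'_eq_one (by omega)
  have hγ1 : ‖β ^ (k + 1)‖ = 1 := by rw [norm_pow, hβ1, one_pow]
  have hplus : ∀ z : ℂ, ‖-1 * z - 1‖ = ‖-z - 1‖ := fun z => by rw [neg_one_mul]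
  rw [mul_pow, hkodd.neg_one_pow, hplus, hplus] at hkey
  have h2 : ‖(-1 : ℂ) - 1‖ ≠ 0 := by norm_num
  have hkey' : ‖-β ^ (k + 1) - 1‖ * ‖β - 1‖ = ‖β ^ (k + 1) - 1‖ * ‖-β - 1‖ := by
    apply mul_right_cancel₀ h2
    linear_combination hkey
  have hsq := congrArg (· ^ 2) hkey'
  simp only [mul_pow] at hsq
  rw [sq_norm_sub_one_of_norm_eq_one hβ1, sq_norm_sub_one_of_norm_eq_one hγ1,
    sq_norm_sub_one_of_norm_eq_one (by rwa [norm_neg]),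
    sq_norm_sub_one_of_norm_eq_one (by rwa [norm_neg]), Complex.neg_re, Complex.neg_re] at hsq
  have hprod : β ^ (k + 1) * β ^ 2 = 1 := by
    rw [← pow_add, show k + 1 + 2 = 2 + k + 1 by ring, hβ.pow_eq_one]
  -- With `γ = β ^ (k + 1)`, `hsq` reads `(1 + Re γ)(1 - Re β) = (1 - Re γ)(1 + Re β)` up to a
  -- factor, so `Re γ = Re β`.
  rcases eq_or_mul_eq_one_of_re_eq hγ1 hβ1 (by linarith) with h | h
  · rw [h, ← pow_succ'] at hprod
    exact absurd (Nat.le_of_dvd three_pos (hβ.dvd_of_pow_eq_one _ hprod)) (by omega)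
  · have : β = 1 := by
      rw [sq, ← mul_assoc, h, one_mul] at hprod
      exact hprod
    exact hβ.ne_one (by omega) this

theorem orderOf_eq_two_and_three {G : Type*} [Group G] (hG : adicResidue G = ⊥) {a b : G}
    (h : (orderOf a).Coprime (orderOf b)) (ha : orderOf a ≠ 1) (hb : orderOf b ≠ 1) :
    orderOf a = 2 ∧ orderOf b = 3 ∨ orderOf a = 3 ∧ orderOf b = 2 := by
  have hab := (commute_of_coprime_orderOf hG h).orderOf_mul_eq_mul_orderOf_of_coprime h
  have ha0 : orderOf a ≠ 0 := fun h0 => hb (by rwa [h0, Nat.coprime_zero_left] at h)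
  have hb0 : orderOf b ≠ 0 := fun h0 => ha (by rwa [h0, Nat.coprime_zero_right] at h)
  rcases Nat.lt_or_ge 2 (orderOf a) with ha2 | ha2
  · rcases Nat.lt_or_ge 2 (orderOf b) with hb2 | hb2
    · exact (not_two_lt_of_adicResidue_eq_bot hG hab h ha2 hb2).elim
    · have hb' : orderOf b = 2 := by omega
      rw [hb'] at h hab
      rw [mul_comm] at hab
      have : ¬3 < orderOf a := not_three_lt_of_adicResidue_eq_bot hG hab h.symm
      omega
  · have ha' : orderOf a = 2 := by omega
    rw [ha'] at h hab
    have : ¬3 < orderOf b := not_three_lt_of_adicResidue_eq_bot hG hab h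
    have : orderOf b ≠ 2 := fun h2 => by rw [h2] at h; norm_num at h
    omega

/-! ### Bicyclic units -/

/-- Otherwise `η = (t - 1)(a - 1) b (1 + a + a²)` is nonzero of square zero, and `1 + η` is a
nontrivial unit in the residue. The three alternatives say that `a b` lies in `b⟨a⟩`. -/
theorem mul_eq_of_orderOf_eq_three {G : Type*} [Group G] (hG : adicResidue G = ⊥) {t a b : G}
    (ht : orderOf t = 2) (ha : orderOf a = 3) :
    a * b = b ∨ a * b = b * a ∨ a * b = b * a ^ 2 := by
  classical
  by_contra! hne
  obtain ⟨hne0, hne1, hne2⟩ := hne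
  have hcop : (orderOf t).Coprime (orderOf a) := by rw [ht, ha]; norm_num
  have hta := commute_of_coprime_orderOf hG hcop
  have ht2 : t ^ 2 = 1 := ht ▸ pow_orderOf_eq_one t
  have ha3 : a ^ 3 = 1 := ha ▸ pow_orderOf_eq_one a
  let o := MonoidAlgebra.of ℤ G
  let η : MonoidAlgebra ℤ G := (o t - 1) * (o a - 1) * o b * (1 + o a + o a ^ 2)
  have hη : η * η = 0 := by
    have h1 : (1 + o a + o a ^ 2) * (o t - 1) = (o t - 1) * (1 + o a + o a ^ 2) := by
      have h2 : Commute (o t) (o a) := hta.map o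
      have h3 : Commute (1 + o a + o a ^ 2) (o t - 1) :=
        (((Commute.one_left _).add_left (h2.symm.sub_right (Commute.one_right _))).add_left
          ((h2.symm.sub_right (Commute.one_right _)).pow_left 2))
      exact h3.eq
    have h4 : (1 + o a + o a ^ 2) * (o a - 1) = 0 := by
      have : (1 + o a + o a ^ 2) * (o a - 1) = o a ^ 3 - 1 := by noncomm_ring
      rw [this, ← map_pow, ha3, map_one, sub_self]
    calc η * η = (o t - 1) * (o a - 1) * o b * ((1 + o a + o a ^ 2) * (o t - 1)) *
          (o a - 1) * o b * (1 + o a + o a ^ 2) := by simp only [η, mul_assoc]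
      _ = (o t - 1) * (o a - 1) * o b * (o t - 1) * ((1 + o a + o a ^ 2) *
          (o a - 1)) * o b * (1 + o a + o a ^ 2) := by rw [h1]; simp only [mul_assoc]
      _ = 0 := by rw [h4]; simp
  have hη0 : η ≠ 0 := by
    intro h0
    -- At `b`, the positive terms contribute at least 1. Each negative term is `t b x` or `a b x`
    -- with `x ∈ ⟨a⟩`: the former equals `b` only if `t` is conjugate to `x⁻¹`, the latter only in
    -- an excluded case.
    have hexp : η = (o (t * a * b) + o (t * a * b * a) + o (t * a * b * a ^ 2) +
        o b + o (b * a) + o (b * a ^ 2)) - (o (t * b * 1) + o (t * b * a) + o (t * b * a ^ 2) +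
        o (a * b * 1) + o (a * b * a) + o (a * b * a ^ 2)) := by
      simp only [map_mul, map_pow, map_one, η]
      noncomm_ring
    have hcoeff : ∀ x : G, (o x).coeff b = if x = b then 1 else 0 := fun x => by
      rw [MonoidAlgebra.of_apply, MonoidAlgebra.coeff_single, Finsupp.single_apply]
    have hnonneg : ∀ x : G, 0 ≤ (o x).coeff b := fun x => by
      rw [hcoeff]; split_ifs <;> simp
    have ht_ne : ∀ x : G, x ^ 3 = 1 → (o (t * b * x)).coeff b = 0 := by
      intro x hx
      rw [hcoeff, if_neg]
      intro h
      have h1 : t = b * x⁻¹ * b⁻¹ := by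
        rw [eq_mul_inv_iff_mul_eq, eq_mul_inv_iff_mul_eq]
        exact h
      have h2 : t ^ 3 = 1 := by rw [h1, conj_pow, inv_pow, hx]; group
      rw [pow_succ, ht2, one_mul] at h2
      rw [h2, orderOf_one] at ht
      norm_num at ht
    have ha_ne : ∀ x y : G, y * x = 1 → a * b ≠ b * y → (o (a * b * x)).coeff b = 0 := by
      intro x y hyx hne
      rw [hcoeff, if_neg]
      intro h
      apply hne
      apply mul_right_cancel (b := x)
      rw [h, mul_assoc, hyx, mul_one]
    have hc := congrArg (fun x => MonoidAlgebra.coeff x b) hexp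
    simp only [h0, MonoidAlgebra.coeff_sub, MonoidAlgebra.coeff_add, Finsupp.sub_apply,
      Finsupp.add_apply, MonoidAlgebra.coeff_zero, Finsupp.zero_apply] at hc
    rw [ht_ne 1 (one_pow 3), ht_ne a ha3, ht_ne (a ^ 2) (by rw [← pow_mul, mul_comm, pow_mul, ha3,
      one_pow]), ha_ne 1 1 (one_mul 1) (by rwa [mul_one]), ha_ne a (a ^ 2) (by rw [← pow_succ, ha3])
      hne2, ha_ne (a ^ 2) a (by rw [← pow_succ', ha3]) hne1] at hc
    have h1 : (o b).coeff b = 1 := by rw [hcoeff, if_pos rfl]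
    have := hnonneg (t * a * b)
    have := hnonneg (t * a * b * a)
    have := hnonneg (t * a * b * a ^ 2)
    have := hnonneg (b * a)
    have := hnonneg (b * a ^ 2)
    omega
  let u : (MonoidAlgebra ℤ G)ˣ :=
    { val := 1 + η
      inv := 1 - η
      val_inv := by rw [add_mul, mul_sub, mul_sub, hη]; simp
      inv_val := by rw [sub_mul, mul_add, mul_add, hη]; simp }
  have hu : u ∈ adicResidue G := by
    refine mem_adicResidue_of_sub_one_mem u fun n => ?_
    have : (u : MonoidAlgebra ℤ G) - 1 = η := add_sub_cancel_left 1 η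
    rw [this]
    exact Ideal.mul_mem_right _ _ (Ideal.mul_mem_right _ _ (of_sub_one_mul_of_sub_one_mem hcop n))
  rw [hG, Subgroup.mem_bot, Units.ext_iff] at hu
  exact hη0 (by simpa [u] using hu)

/-! ### The structure of the group -/

/-- If `y` inverted `x`, so would `y³ = 1`, giving `x = x²`. -/
theorem commute_of_pow_three_eq_one {G : Type*} [Group G] (hG : adicResidue G = ⊥) {t x y : G}
    (ht : orderOf t = 2) (hx : x ^ 3 = 1) (hy : y ^ 3 = 1) : Commute x y := by
  by_cases hx1 : x = 1
  · rw [hx1]; exact Commute.one_left y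
  have hx3 : orderOf x = 3 := orderOf_eq_prime hx hx1
  rcases mul_eq_of_orderOf_eq_three hG ht hx3 (b := y) with h | h | h
  · exact absurd (mul_eq_right.1 h) hx1
  · exact h
  · have h1 : x * y ^ 2 = y ^ 2 * x := by
      have hx4 : x ^ 2 * x ^ 2 = x := by
        rw [← pow_add, show 2 + 2 = 3 + 1 from rfl, pow_succ, hx, one_mul]
      have hx2 : x ^ 2 * y = y * x := by
        rw [sq, mul_assoc, h, ← mul_assoc, h, mul_assoc, hx4]
      rw [sq, ← mul_assoc, h, mul_assoc, hx2, ← mul_assoc]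
    have h2 : x * y ^ 3 = y ^ 3 * x ^ 2 := by
      rw [pow_succ, ← mul_assoc, h1, mul_assoc, h, mul_assoc]
    rw [hy, mul_one, one_mul, sq] at h2
    exact absurd (left_eq_mul.1 h2) hx1

/-- `(x y)²` has order dividing 3, so it commutes with `x`; conjugation by `x` also inverts it.
Hence `(x y)⁴ = 1`, and `(x y)⁶ = 1` leaves `(x y)² = 1`. -/
theorem commute_of_sq_eq_one {G : Type*} [Group G] (hG : adicResidue G = ⊥)
    (h6 : ∀ g : G, g ^ 6 = 1) {x y : G} (hx : x ^ 2 = 1) (hy : y ^ 2 = 1) : Commute x y := by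
  have hcop : (orderOf x).Coprime (orderOf ((x * y) ^ 2)) :=
    Nat.Coprime.of_dvd (orderOf_dvd_of_pow_eq_one hx)
      (orderOf_dvd_of_pow_eq_one (n := 3) (by rw [← pow_mul, h6])) (by norm_num)
  have hc : x * (x * y) ^ 2 = (x * y) ^ 2 * x := commute_of_coprime_orderOf hG hcop
  have hxi : x⁻¹ = x := inv_eq_of_mul_eq_one_left (by rw [← sq, hx])
  have hyi : y⁻¹ = y := inv_eq_of_mul_eq_one_left (by rw [← sq, hy])
  have hinv : (x * y)⁻¹ = y * x := by rw [mul_inv_rev, hxi, hyi]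
  have h1 : (y * x) ^ 2 = (x * y) ^ 2 := by
    calc (y * x) ^ 2 = x ^ 2 * (y * x) ^ 2 := by rw [hx, one_mul]
      _ = x * (x * y) ^ 2 * x := by simp only [sq, mul_assoc]
      _ = (x * y) ^ 2 * x ^ 2 := by rw [hc, mul_assoc, sq x]
      _ = (x * y) ^ 2 := by rw [hx, mul_one]
  have h4 : (x * y) ^ 4 = 1 := by
    rw [show 4 = 2 + 2 from rfl, pow_add]
    nth_rewrite 1 [← h1]
    rw [← hinv, inv_pow, inv_mul_cancel]
  have h2 : (x * y) ^ 2 = 1 := by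
    have := h6 (x * y)
    rwa [show 6 = 4 + 2 from rfl, pow_add, h4, one_mul] at this
  change x * y = y * x
  rw [← hinv, eq_inv_iff_mul_eq_one, ← sq, h2]

/-- The odd part of `g` is compared with `t` and the 2-part with `c`. -/
theorem pow_six_eq_one {G : Type*} [Group G] [Finite G] (hG : adicResidue G = ⊥) {t c : G}
    (ht : orderOf t = 2) (hc : orderOf c = 3) (g : G) : g ^ 6 = 1 := by
  obtain ⟨i, m, hm, hn⟩ := Nat.exists_eq_two_pow_mul_odd (orderOf_pos g).ne'
  have h1 : orderOf (g ^ 2 ^ i) = m := by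
    rw [orderOf_pow_of_dvd (by positivity) (hn ▸ dvd_mul_right _ _), hn,
      Nat.mul_div_cancel_left _ (by positivity)]
  have h2 : orderOf (g ^ m) = 2 ^ i := by
    rw [orderOf_pow_of_dvd hm.pos.ne' (hn ▸ dvd_mul_left _ _), hn, Nat.mul_div_cancel _ hm.pos]
  have hm3 : m ∣ 3 := by
    by_cases hm1 : m = 1
    · rw [hm1]; exact one_dvd 3
    have := orderOf_eq_two_and_three hG (a := t) (b := g ^ 2 ^ i)
      (by rw [ht, h1]; exact Nat.coprime_two_left.2 hm) (by omega) (by omega)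
    rw [show m = 3 by omega]
  have hi2 : 2 ^ i ∣ 2 := by
    by_cases hi1 : 2 ^ i = 1
    · rw [hi1]; exact one_dvd 2
    have := orderOf_eq_two_and_three hG (a := g ^ m) (b := c)
      (by rw [hc, h2]; exact Nat.Coprime.pow_left i (by norm_num)) (by omega) (by omega)
    rw [show 2 ^ i = 2 by omega]
  refine orderOf_dvd_iff_pow_eq_one.1 ?_
  rw [hn]
  exact mul_dvd_mul hi2 hm3

theorem commute_of_adicResidue_eq_bot {G : Type*} [Group G] [Finite G] (hG : adicResidue G = ⊥)
    {t c : G} (ht : orderOf t = 2) (hc : orderOf c = 3) (g h : G) : Commute g h := by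
  have h6 := pow_six_eq_one hG ht hc
  -- `g³` and `g⁴` serve as the 2-part and the 3-part of `g`.
  have hdecomp : ∀ g : G, g = g ^ 3 * g ^ 4 := fun g => by
    rw [← pow_add, show 3 + 4 = 6 + 1 from rfl, pow_succ, h6, one_mul]
  have h3 : ∀ g : G, (g ^ 3) ^ 2 = 1 := fun g => by rw [← pow_mul, h6]
  have h4 : ∀ g : G, (g ^ 4) ^ 3 = 1 := fun g => by
    rw [← pow_mul, show 4 * 3 = 6 * 2 from rfl, pow_mul, h6, one_pow]
  have h34 : ∀ g h : G, Commute (g ^ 3) (h ^ 4) := fun g h =>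
    commute_of_coprime_orderOf hG (Nat.Coprime.of_dvd (orderOf_dvd_of_pow_eq_one (h3 g))
      (orderOf_dvd_of_pow_eq_one (h4 h)) (by norm_num))
  rw [hdecomp g, hdecomp h]
  exact ((commute_of_sq_eq_one hG h6 (h3 g) (h3 h)).mul_right (h34 g h)).mul_left
    ((h34 h g).symm.mul_right (commute_of_pow_three_eq_one hG ht (h4 g) (h4 h)))

theorem exists_isPGroup_or_exists_orderOf_two_three {G : Type*} [Group G] [Finite G]
    (hG : adicResidue G = ⊥) :
    (∃ p : ℕ, p.Prime ∧ IsPGroup p G) ∨ ∃ t c : G, orderOf t = 2 ∧ orderOf c = 3 := by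
  by_cases h1 : Nat.card G = 1
  · exact Or.inl ⟨2, Nat.prime_two, IsPGroup.of_card (n := 0) (by rw [h1, pow_zero])⟩
  have hp := Nat.minFac_prime h1
  set p := (Nat.card G).minFac
  by_cases hu : ∀ {d : ℕ}, d.Prime → d ∣ Nat.card G → d = p
  · exact Or.inl ⟨p, hp, IsPGroup.of_card (Nat.eq_prime_pow_of_unique_prime_dvd Nat.card_pos.ne' hu)⟩
  · push Not at hu
    obtain ⟨q, hq, hqd, hqp⟩ := hu
    have := Fact.mk hp
    have := Fact.mk hq
    obtain ⟨a, ha⟩ := exists_prime_orderOf_dvd_card' (G := G) p (Nat.minFac_dvd _)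
    obtain ⟨b, hb⟩ := exists_prime_orderOf_dvd_card' (G := G) q hqd
    refine Or.inr ?_
    rcases orderOf_eq_two_and_three hG (a := a) (b := b)
      (by rw [ha, hb]; exact (Nat.coprime_primes hp hq).2 hqp.symm) (by rw [ha]; exact hp.ne_one)
      (by rw [hb]; exact hq.ne_one) with h | h
    · exact ⟨a, b, h⟩
    · exact ⟨b, a, h.symm⟩

end IntegralGroupRing

theorem mainTheorem2 (G : Type*) [Group G] [Finite G] :
    IntegralGroupRing.adicResidue G = ⊥ ↔
      ((∀ a b : G, a * b = b * a) ∧ Monoid.exponent G = 6) ∨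
        ∃ p : ℕ, p.Prime ∧ IsPGroup p G := by
  open IntegralGroupRing in
  constructor
  · intro hG
    rcases exists_isPGroup_or_exists_orderOf_two_three hG with h | ⟨t, c, ht, hc⟩
    · exact Or.inr h
    · refine Or.inl ⟨fun a b => commute_of_adicResidue_eq_bot hG ht hc a b, ?_⟩
      refine Nat.dvd_antisymm
        (Monoid.exponent_dvd_of_forall_pow_eq_one (pow_six_eq_one hG ht hc)) ?_
      exact Nat.Coprime.mul_dvd_of_dvd_of_dvd (m := 2) (n := 3) (by norm_num)
        (ht ▸ Monoid.order_dvd_exponent t) (hc ▸ Monoid.order_dvd_exponent c)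
  · rintro (⟨hcomm, hexp⟩ | ⟨p, hp, hG⟩)
    · let _ : CommGroup G := { ‹Group G› with mul_comm := hcomm }
      exact adicResidue_eq_bot_of_pow_six fun g => hexp ▸ Monoid.pow_exponent_eq_one g
    · exact adicResidue_eq_bot_of_isPGroup hp hG
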